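/- Let $(R,\mathfrak m)$ be a Noetherian local domain of Krull dimension $1$ with field of fractions $Q(R)$, and assume that its integral closure $\overline R\subseteq Q(R)$ is a discrete valuation ring, is finitely generated as an $R$-module, and that the induced map of residue class fields $R/\mathfrak m\to\overline R/\mathfrak n$ is an isomorphism, where $\mathfrak n$ is the maximal ideal of $\overline R$. Let $C=R:\overline R=\{f\in R : f\overline R\subseteq R\}$ be the conductor of $R$. For a nonzero fractionary ideal $J$ of $R$ put $J^{-1}=\{f\in Q(R): fJ\subseteq R\}$. The trace of a finitely generated $R$-module $M$ is the ideal $\operatorname{tr}(M)=\sum_{\varphi\in\operatorname{Hom}_R(M,R)}\varphi(M)$. An ideal of $R$ is called a trace ideal if it is the trace of some finitely generated $R$-module. For an ideal $I$ of $R$, let $\operatorname{subtr}(I)$ denote the largest (with respect to inclusion) trace ideal contained in $I$, that is, the sum of all trace ideals contained in $I$. Assume that $R$ is Gorenstein (that is, $R$ has finite injective dimension as a module over itself), and let $I$ be an ideal of $R$ with $C\subseteq I\subseteq R$. Then there exists an integer $k_0\ge 0$ such that $(I^{-1})^{k}=(I^{-1})^{k_0}$ for all $k\geq k_0$. Moreover,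 for every such $k_0$, setting $J=(I^{-1})^{k_0}$, the largest trace ideal $\operatorname{subtr}(I)$ contained in $I$ exists and $\operatorname{subtr}(I)=J^{-1}$. -/

import Mathlib

open scoped nonZeroDivisors

universe u

/-- The trace of an `R`-module `M`: the sum of the images of all `R`-linear maps `M → R`. -/
def Module.traceIdeal (R : Type*) [CommRing R] (M : Type*) [AddCommGroup M] [Module R M] :
    Ideal R :=
  ⨆ φ : M →ₗ[R] R, LinearMap.range φ

/-- An ideal is a trace ideal if it is the trace of some finitely generated module. (Every finitely
generated `R`-module is isomorphic to one in the universe of `R`, and the trace is invariant under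
isomorphism.) -/
def Ideal.IsTraceIdeal {R : Type u} [CommRing R] (I : Ideal R) : Prop :=
  ∃ (M : Type u) (_ : AddCommGroup M) (_ : Module R M),
    Module.Finite R M ∧ I = Module.traceIdeal R M

/-- The sum of all trace ideals contained in `I`. -/
def Ideal.subtr {R : Type u} [CommRing R] (I : Ideal R) : Ideal R :=
  sSup {T : Ideal R | T.IsTraceIdeal ∧ T ≤ I}

/-- A commutative ring is a Gorenstein local ring if it is a Noetherian local ring which has finite
injective dimension as a module over itself. -/
structure IsGorensteinLocalRing (R : Type u) [CommRing R] : Prop where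
  isNoetherianRing : IsNoetherianRing R
  isLocalRing : IsLocalRing R
  exists_injectiveDimensionLE :
    ∃ n : ℕ, CategoryTheory.HasInjectiveDimensionLE (ModuleCat.of R R) n

/-- The conductor `C = R : R̄` of `R`, where `R̄` is the integral closure of `R` in its fraction
field `K`, as an ideal of `R`. -/
def integralClosureConductor (R K : Type*) [CommRing R] [Field K] [Algebra R K] : Ideal R where
  carrier := {r | ∀ x ∈ integralClosure R K, ∃ s : R, algebraMap R K s = algebraMap R K r * x}
  zero_mem' := fun x _ => ⟨0, by simp⟩
  add_mem' := by
    intro a b ha hb x hx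
    obtain ⟨s, hs⟩ := ha x hx
    obtain ⟨t, ht⟩ := hb x hx
    exact ⟨s + t, by rw [map_add, map_add, add_mul, hs, ht]⟩
  smul_mem' := by
    intro c a ha x hx
    obtain ⟨s, hs⟩ := ha x hx
    exact ⟨c * s, by rw [smul_eq_mul, map_mul, map_mul, hs, mul_assoc]⟩

/-!
The trace of an ideal `T` is `T⁻¹ T`, so `T` is a trace ideal iff `T⁻¹ T ⊆ T`. Since `I` contains
the conductor `C`, the powers of `I⁻¹` lie in `C⁻¹ = R̄` (`C⁻¹` stabilizes `C`, hence is integral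
over `R`) and increase, so they become stationary at a fractional ideal `J` with `J J ⊆ J`. Then
`J⁻¹` is stable under `J⁻¹⁻¹`, that is, it is a trace ideal. It contains every trace ideal
`T ⊆ I`, because `I⁻¹ T ⊆ T⁻¹ T ⊆ T` gives `J T ⊆ T ⊆ R`; and it is contained in `I` as soon as
`I⁻¹⁻¹ = I`.

This reflexivity is where the Gorenstein hypothesis enters. `Ext²(M, R)` vanishes for every finitely
generated `M`: in high degrees this is finite injective dimension, and one descends from degree
`n + 3` to `n + 2` by reducing to `M = R / p` and embedding `R / p` into `R / (x)` for some nonzero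
`x ∈ p`, possible because `p` is minimal over `(x)` in dimension one. Vanishing of `Ext²` makes
`M → M**` surjective, and for `M = I` the elements of `I⁻¹⁻¹` are functionals on `I* = I⁻¹`.
-/

section Ext

open CategoryTheory Abelian

universe v w

variable {C : Type u} [Category.{v} C] [Abelian C] [HasExt.{w} C] {S : ShortComplex C}

theorem subsingleton_ext_X₁_of_shortExact (hS : S.ShortExact) (Y : C) (n : ℕ)
    (h₂ : Subsingleton (Ext S.X₂ Y n)) (h₃ : Subsingleton (Ext S.X₃ Y (n + 1))) :
    Subsingleton (Ext S.X₁ Y n) := by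
  refine subsingleton_of_forall_eq 0 fun e => ?_
  obtain ⟨e', rfl⟩ :=
    Ext.contravariant_sequence_exact₁ hS Y e (Nat.add_comm 1 n) (h₃.elim _ _)
  rw [h₂.elim e' 0, Ext.comp_zero]

theorem subsingleton_ext_X₂_of_shortExact (hS : S.ShortExact) (Y : C) (n : ℕ)
    (h₁ : Subsingleton (Ext S.X₁ Y n)) (h₃ : Subsingleton (Ext S.X₃ Y n)) :
    Subsingleton (Ext S.X₂ Y n) := by
  refine subsingleton_of_forall_eq 0 fun e => ?_
  obtain ⟨e', rfl⟩ := Ext.contravariant_sequence_exact₂ hS Y e (h₁.elim _ _)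
  rw [h₃.elim e' 0, Ext.comp_zero]

theorem subsingleton_ext_X₃_of_shortExact (hS : S.ShortExact) (Y : C) (n : ℕ)
    (h₁ : Subsingleton (Ext S.X₁ Y n)) (h₂ : Subsingleton (Ext S.X₂ Y (n + 1))) :
    Subsingleton (Ext S.X₃ Y (n + 1)) := by
  refine subsingleton_of_forall_eq 0 fun e => ?_
  obtain ⟨e', rfl⟩ :=
    Ext.contravariant_sequence_exact₃ hS Y e (h₂.elim _ _) (Nat.add_comm 1 n)
  rw [h₁.elim e' 0, Ext.comp_zero]

theorem exists_comp_eq_of_subsingleton_ext_one (hS : S.ShortExact) {Y : C}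
    (h₃ : Subsingleton (Ext S.X₃ Y 1)) (φ : S.X₁ ⟶ Y) : ∃ ψ : S.X₂ ⟶ Y, S.f ≫ ψ = φ := by
  obtain ⟨e, he⟩ :=
    Ext.contravariant_sequence_exact₁ hS Y (Ext.mk₀ φ) (zero_add 1) (h₃.elim _ _)
  obtain ⟨ψ, rfl⟩ := Ext.homEquiv₀.symm.surjective e
  exact ⟨ψ, Ext.homEquiv₀.symm.injective (by simpa using he)⟩

end Ext

section ModuleExt

open CategoryTheory Abelian

variable {R : Type u} [CommRing R] {M N P : Type u} [AddCommGroup M] [Module R M]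
  [AddCommGroup N] [Module R N] [AddCommGroup P] [Module R P]

theorem shortExact_shortComplexOfCompEqZero {f : M →ₗ[R] N} {g : N →ₗ[R] P}
    (hf : Function.Injective f) (hg : Function.Surjective g) (hfg : Function.Exact f g) :
    (ModuleCat.shortComplexOfCompEqZero f g hfg.linearMap_comp_eq_zero).ShortExact :=
  ModuleCat.shortComplex_shortExact _ hfg hf hg

theorem subsingleton_ext_of_exact {f : M →ₗ[R] N} {g : N →ₗ[R] P}
    (hf : Function.Injective f) (hg : Function.Surjective g) (hfg : Function.Exact f g)
    (Y : ModuleCat.{u} R) (n : ℕ) (hM : Subsingleton (Ext (ModuleCat.of R M) Y n))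
    (hP : Subsingleton (Ext (ModuleCat.of R P) Y n)) :
    Subsingleton (Ext (ModuleCat.of R N) Y n) :=
  subsingleton_ext_X₂_of_shortExact (shortExact_shortComplexOfCompEqZero hf hg hfg) Y n hM hP

theorem subsingleton_ext_of_injective {f : M →ₗ[R] N} (hf : Function.Injective f)
    (Y : ModuleCat.{u} R) (n : ℕ) (hN : Subsingleton (Ext (ModuleCat.of R N) Y n))
    (hQ : Subsingleton (Ext (ModuleCat.of R (N ⧸ LinearMap.range f)) Y (n + 1))) :
    Subsingleton (Ext (ModuleCat.of R M) Y n) :=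
  subsingleton_ext_X₁_of_shortExact (shortExact_shortComplexOfCompEqZero hf
    (Submodule.mkQ_surjective _) f.exact_map_mkQ_range) Y n hN hQ

theorem subsingleton_ext_of_projective [Module.Projective R P] (Y : ModuleCat.{u} R) (n : ℕ) :
    Subsingleton (Ext (ModuleCat.of R P) Y (n + 1)) :=
  Ext.subsingleton_of_projective _ _ n

theorem subsingleton_ext_quotient_range_of_projective [Module.Projective R M]
    [Module.Projective R N] {f : M →ₗ[R] N} (hf : Function.Injective f) (Y : ModuleCat.{u} R)
    (n : ℕ) : Subsingleton (Ext (ModuleCat.of R (N ⧸ LinearMap.range f)) Y (n + 2)) :=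
  subsingleton_ext_X₃_of_shortExact (shortExact_shortComplexOfCompEqZero hf
    (Submodule.mkQ_surjective _) f.exact_map_mkQ_range) Y (n + 1)
    (subsingleton_ext_of_projective Y n) (subsingleton_ext_of_projective Y (n + 1))

theorem exists_extend_of_subsingleton_ext_two {Q : Type u} [AddCommGroup Q] [Module R Q]
    [Module.Projective R P] {f : M →ₗ[R] N} {g : N →ₗ[R] P} (hf : Function.Injective f)
    (hfg : Function.Exact f g)
    (hg : Subsingleton (Ext (ModuleCat.of R (P ⧸ LinearMap.range g)) (ModuleCat.of R Q) 2))
    (φ : M →ₗ[R] Q) : ∃ ψ : N →ₗ[R] Q, ψ ∘ₗ f = φ := by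
  have hrange : Subsingleton (Ext (ModuleCat.of R (LinearMap.range g)) (ModuleCat.of R Q) 1) :=
    subsingleton_ext_of_injective (Submodule.injective_subtype _) _ 1
      (subsingleton_ext_of_projective _ 0) (by rwa [Submodule.range_subtype])
  have hfg' : Function.Exact f g.rangeRestrict := fun x => by
    rw [← hfg x, ← Subtype.val_inj]; rfl
  obtain ⟨ψ, hψ⟩ := exists_comp_eq_of_subsingleton_ext_one
    (shortExact_shortComplexOfCompEqZero hf g.surjective_rangeRestrict hfg') hrange
    (ModuleCat.ofHom φ)
  exact ⟨ψ.hom, congrArg ModuleCat.Hom.hom hψ⟩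

end ModuleExt

section DimensionOne

open CategoryTheory Abelian

variable {R : Type u} [CommRing R]

theorem exists_injective_quotient_of_mem_minimalPrimes [IsNoetherianRing R] {I p : Ideal R}
    (hp : p ∈ I.minimalPrimes) : ∃ f : R ⧸ p →ₗ[R] R ⧸ I, Function.Injective f := by
  rw [← Ideal.annihilator_quotient (I := I)] at hp
  exact ((isAssociatedPrime_iff_exists_injective_linearMap p (R ⧸ I)).1
    (Module.associatedPrimes.minimalPrimes_annihilator_subset_associatedPrimes R (R ⧸ I) hp)).2

theorem subsingleton_ext_quotient_span_singleton {x : R} (hx : IsRegular x) (Y : ModuleCat.{u} R)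
    (n : ℕ) : Subsingleton (Ext (ModuleCat.of R (R ⧸ Ideal.span {x})) Y (n + 2)) := by
  have hinj : Function.Injective (LinearMap.toSpanSingleton R R x) := hx.right
  have := subsingleton_ext_quotient_range_of_projective hinj Y n
  rwa [LinearMap.range_toSpanSingleton] at this

variable [IsDomain R]

theorem mem_minimalPrimes_of_krullDimLE_one [Ring.KrullDimLE 1 R] {I p : Ideal R}
    (hI : I ≠ ⊥) (hp : p.IsPrime) (hIp : I ≤ p) : p ∈ I.minimalPrimes :=
  ⟨⟨hp, hIp⟩, fun _ hq hqp =>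
    ((hq.1.isMaximal_of_ne_bot (ne_bot_of_le_ne_bot hI hq.2)).eq_of_le hp.ne_top hqp).ge⟩

variable [IsNoetherianRing R] [Ring.KrullDimLE 1 R]

theorem subsingleton_ext_add_two_of_succ (Y : ModuleCat.{u} R) (n : ℕ)
    (h : ∀ (M : Type u) [AddCommGroup M] [Module R M] [Module.Finite R M],
      Subsingleton (Ext (ModuleCat.of R M) Y (n + 3)))
    (M : Type u) [AddCommGroup M] [Module R M] [hM : Module.Finite R M] :
    Subsingleton (Ext (ModuleCat.of R M) Y (n + 2)) := by
  induction hM using IsNoetherianRing.induction_on_isQuotientEquivQuotientPrime R with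
  | subsingleton N => exact subsingleton_ext_of_projective Y (n + 1)
  | exact N₁ N₂ N₃ f g hf hg hfg h₁ h₃ => exact subsingleton_ext_of_exact hf hg hfg Y _ h₁ h₃
  | quotient N p e =>
    by_cases hp : p.asIdeal = ⊥
    · have : Module.Free R N :=
        Module.Free.of_equiv ((Submodule.quotEquivOfEqBot _ hp).symm.trans e.symm)
      exact subsingleton_ext_of_projective Y (n + 1)
    · obtain ⟨x, hxp, hx⟩ := p.asIdeal.ne_bot_iff.1 hp
      obtain ⟨f, hf⟩ := exists_injective_quotient_of_mem_minimalPrimes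
        (mem_minimalPrimes_of_krullDimLE_one (mt Ideal.span_singleton_eq_bot.1 hx) p.isPrime
          ((Ideal.span_singleton_le_iff_mem _).2 hxp))
      exact subsingleton_ext_of_injective (f := f ∘ₗ e.toLinearMap) (hf.comp e.injective) Y (n + 2)
        (subsingleton_ext_quotient_span_singleton (.of_ne_zero hx) Y n) (h _)

theorem subsingleton_ext_two_of_hasInjectiveDimensionLE {Y : ModuleCat.{u} R} {d : ℕ}
    (hY : HasInjectiveDimensionLE Y d) (M : Type u) [AddCommGroup M] [Module R M]
    [Module.Finite R M] : Subsingleton (Ext (ModuleCat.of R M) Y 2) := by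
  suffices h : ∀ n : ℕ, (∀ (M : Type u) [AddCommGroup M] [Module R M] [Module.Finite R M],
      Subsingleton (Ext (ModuleCat.of R M) Y (n + 2))) →
      ∀ (M : Type u) [AddCommGroup M] [Module R M] [Module.Finite R M],
        Subsingleton (Ext (ModuleCat.of R M) Y 2) from
    h d (fun N _ _ _ => HasInjectiveDimensionLT.subsingleton Y (d + 1) (d + 2) (by lia) _) M
  intro n
  induction n with
  | zero => exact id
  | succ n ih => exact fun h => ih (subsingleton_ext_add_two_of_succ Y n h)

theorem surjective_dual_eval_of_hasInjectiveDimensionLE {d : ℕ}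
    (hR : HasInjectiveDimensionLE (ModuleCat.of R R) d) (M : Type u) [AddCommGroup M]
    [Module R M] [Module.Finite R M] : Function.Surjective (Module.Dual.eval R M) := by
  -- Dualizing a presentation `G → F → M → 0` embeds `F* / M*` into `G*`; let `N` be the cokernel.
  -- As `Ext²(N, R) = 0`, functionals on `M*` extend to `F*`, where they are evaluations.
  intro Φ
  obtain ⟨F, _, _, _, _, π, hπ⟩ := Module.exists_finite_presentation R M
  obtain ⟨G, _, _, _, _, τ, hτ⟩ := Module.exists_finite_presentation R (LinearMap.ker π)
  have hexact : Function.Exact ((LinearMap.ker π).subtype ∘ₗ τ) π :=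
    hτ.comp_exact_iff_exact.2 π.exact_subtype_ker_map
  obtain ⟨Ψ, hΨ⟩ := exists_extend_of_subsingleton_ext_two
    (LinearMap.dualMap_injective_of_surjective hπ)
    (LinearMap.exact_lcomp_of_exact_of_surjective R hexact hπ)
    (subsingleton_ext_two_of_hasInjectiveDimensionLE hR _) Φ
  obtain ⟨v, rfl⟩ := (Module.evalEquiv R F).surjective Ψ
  refine ⟨π v, LinearMap.ext fun ψ => ?_⟩
  rw [← hΨ]
  rfl

end DimensionOne

section FractionalIdeal

variable {R K : Type*} [CommRing R] [IsDomain R] [Field K] [Algebra R K] [IsFractionRing R K]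
  {J L : FractionalIdeal R⁰ K}

theorem fractionalIdeal_inv_mul_le_one (J : FractionalIdeal R⁰ K) : J⁻¹ * J ≤ 1 := by
  rw [mul_comm, FractionalIdeal.inv_eq]
  exact FractionalIdeal.mul_one_div_le_one

theorem le_inv_iff_mul_le_one (hJ : J ≠ 0) : L ≤ J⁻¹ ↔ L * J ≤ 1 := by
  rw [FractionalIdeal.inv_eq, FractionalIdeal.le_div_iff_mul_le hJ]

theorem inv_inv_mul_inv_le (hJ : J * J ≤ J) : J⁻¹⁻¹ * J⁻¹ ≤ J⁻¹ := by
  obtain rfl | hJ0 := eq_or_ne J 0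
  · simp [FractionalIdeal.inv_zero']
  have hmul : J⁻¹ * J ≤ J⁻¹ := by
    rw [le_inv_iff_mul_le_one hJ0, mul_assoc]
    exact (mul_le_mul_right hJ _).trans (fractionalIdeal_inv_mul_le_one J)
  rw [le_inv_iff_mul_le_one hJ0, mul_assoc]
  exact (mul_le_mul_right hmul _).trans (fractionalIdeal_inv_mul_le_one J⁻¹)

end FractionalIdeal

section Dual

variable {R K : Type*} [CommRing R] [Field K] [Algebra R K] [IsFractionRing R K]

theorem exists_algebraMap_comp_eq {M : Type*} [AddCommGroup M] [Module R M] (l : M →ₗ[R] K)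
    (hl : ∀ m, l m ∈ (1 : FractionalIdeal R⁰ K)) :
    ∃ φ : Module.Dual R M, ∀ m, algebraMap R K (φ m) = l m := by
  simp only [FractionalIdeal.mem_one_iff] at hl
  exact ⟨l.codRestrictOfInjective (Algebra.linearMap R K) (IsFractionRing.injective R K) hl,
    l.codRestrictOfInjective_comp_apply (Algebra.linearMap R K) (IsFractionRing.injective R K) hl⟩

theorem algebraMap_dual_apply {I : Ideal R} {a : I} (ha : a ≠ 0) (ψ : Module.Dual R I) (b : I) :
    algebraMap R K (ψ b) = algebraMap R K (ψ a) / algebraMap R K a * algebraMap R K b := by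
  have ha' : algebraMap R K a ≠ 0 := by simpa using ha
  have hab : (a : R) • b = (b : R) • a := Subtype.ext (mul_comm _ _)
  have h : (a : R) * ψ b = b * ψ a := by simpa using congrArg ψ hab
  rw [div_mul_eq_mul_div, eq_div_iff ha', ← map_mul, ← map_mul, mul_comm, h, mul_comm]

variable [IsDomain R]

theorem dual_apply_div_mem_inv_coeIdeal {I : Ideal R} {a : I} (ha : a ≠ 0)
    (ψ : Module.Dual R I) :
    algebraMap R K (ψ a) / algebraMap R K a ∈ (I : FractionalIdeal R⁰ K)⁻¹ := by
  have hI : (I : FractionalIdeal R⁰ K) ≠ 0 :=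
    FractionalIdeal.coeIdeal_ne_zero.2 fun h => ha (by subst h; exact Subsingleton.elim _ _)
  rw [FractionalIdeal.mem_inv_iff hI]
  rintro _ ⟨b, hb, rfl⟩
  exact (FractionalIdeal.mem_one_iff _).2 ⟨ψ ⟨b, hb⟩, algebraMap_dual_apply ha ψ ⟨b, hb⟩⟩

theorem exists_dual_of_mem_inv_coeIdeal {I : Ideal R} (hI : I ≠ ⊥) {x : K}
    (hx : x ∈ (I : FractionalIdeal R⁰ K)⁻¹) :
    ∃ ψ : Module.Dual R I, ∀ b : I, algebraMap R K (ψ b) = x * algebraMap R K b :=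
  exists_algebraMap_comp_eq (LinearMap.mulLeft R x ∘ₗ Algebra.linearMap R K ∘ₗ I.subtype)
    fun b => (FractionalIdeal.mem_inv_iff (FractionalIdeal.coeIdeal_ne_zero.2 hI)).1 hx _
      (FractionalIdeal.mem_coeIdeal_of_mem _ b.2)

theorem inv_inv_coeIdeal_le {I : Ideal R} (hI : Function.Surjective (Module.Dual.eval R I)) :
    (I : FractionalIdeal R⁰ K)⁻¹⁻¹ ≤ I := by
  obtain rfl | hI0 := eq_or_ne I ⊥
  · simp [FractionalIdeal.inv_zero']
  intro x hx
  obtain ⟨a, ha, ha0⟩ := I.ne_bot_iff.1 hI0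
  have ha0' : (⟨a, ha⟩ : I) ≠ 0 := by simpa using ha0
  have hxψ (ψ : Module.Dual R I) :
      x / algebraMap R K a * algebraMap R K (ψ ⟨a, ha⟩) ∈ (1 : FractionalIdeal R⁰ K) := by
    rw [div_mul_eq_mul_div, mul_div_assoc]
    exact fractionalIdeal_inv_mul_le_one _
      (FractionalIdeal.mul_mem_mul hx (dual_apply_div_mem_inv_coeIdeal ha0' ψ))
  obtain ⟨Φ, hΦ⟩ := exists_algebraMap_comp_eq (LinearMap.mulLeft R (x / algebraMap R K a) ∘ₗ
    Algebra.linearMap R K ∘ₗ Module.Dual.eval R I ⟨a, ha⟩) hxψ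
  obtain ⟨t, rfl⟩ := hI Φ
  have ht : algebraMap R K t = x := by
    simpa [ha0] using hΦ I.subtype
  exact ht ▸ FractionalIdeal.mem_coeIdeal_of_mem _ t.2

end Dual

section TraceIdeal

theorem apply_mem_traceIdeal {R M : Type*} [CommRing R] [AddCommGroup M] [Module R M]
    (φ : M →ₗ[R] R) (m : M) : φ m ∈ Module.traceIdeal R M :=
  le_iSup (fun φ : M →ₗ[R] R => LinearMap.range φ) φ ⟨m, rfl⟩

theorem traceIdeal_le_iff {R M : Type*} [CommRing R] [AddCommGroup M] [Module R M]
    {I : Ideal R} : Module.traceIdeal R M ≤ I ↔ ∀ (φ : M →ₗ[R] R) (m : M), φ m ∈ I :=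
  iSup_le_iff.trans (forall_congr' fun _ => LinearMap.range_le_iff_comap.trans
    Submodule.eq_top_iff')

theorem le_traceIdeal_self {R : Type*} [CommRing R] (I : Ideal R) : I ≤ Module.traceIdeal R I :=
  fun a ha => apply_mem_traceIdeal I.subtype ⟨a, ha⟩

theorem traceIdeal_traceIdeal (R M : Type*) [CommRing R] [AddCommGroup M] [Module R M] :
    Module.traceIdeal R (Module.traceIdeal R M) = Module.traceIdeal R M := by
  refine le_antisymm (traceIdeal_le_iff.2 fun ψ t => ?_) (le_traceIdeal_self _)
  obtain ⟨t, ht⟩ := t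
  have hle : Module.traceIdeal R M ≤
      Submodule.map (Module.traceIdeal R M).subtype
        (Submodule.comap ψ (Module.traceIdeal R M)) := by
    refine traceIdeal_le_iff.2 fun φ m => ⟨⟨φ m, apply_mem_traceIdeal φ m⟩, ?_, rfl⟩
    exact apply_mem_traceIdeal
      (ψ ∘ₗ φ.codRestrict (Module.traceIdeal R M) (apply_mem_traceIdeal φ)) m
  obtain ⟨s, hs, rfl⟩ := hle ht
  exact hs

theorem isTraceIdeal_iff_traceIdeal_eq {R : Type u} [CommRing R] [IsNoetherianRing R]
    {T : Ideal R} : T.IsTraceIdeal ↔ Module.traceIdeal R T = T := by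
  refine ⟨?_, fun h => ⟨T, _, _, inferInstance, h.symm⟩⟩
  rintro ⟨M, _, _, _, rfl⟩
  exact traceIdeal_traceIdeal R M

theorem coeIdeal_traceIdeal {R K : Type*} [CommRing R] [IsDomain R] [Field K] [Algebra R K]
    [IsFractionRing R K] (I : Ideal R) :
    (Module.traceIdeal R I : FractionalIdeal R⁰ K) = (I : FractionalIdeal R⁰ K)⁻¹ * I := by
  obtain rfl | hI := eq_or_ne I ⊥
  · have : Module.traceIdeal R (⊥ : Ideal R) = ⊥ :=
      le_bot_iff.1 (traceIdeal_le_iff.2 fun φ m => by simp [Subsingleton.elim m 0])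
    simp [this]
  refine le_antisymm ?_ (FractionalIdeal.mul_le.2 ?_)
  · obtain ⟨a, ha, ha0⟩ := I.ne_bot_iff.1 hI
    have hle : Module.traceIdeal R I ≤ Submodule.comap (Algebra.linearMap R K)
        ((I : FractionalIdeal R⁰ K)⁻¹ * I : FractionalIdeal R⁰ K) := by
      refine traceIdeal_le_iff.2 fun ψ b => ?_
      have ha0' : (⟨a, ha⟩ : I) ≠ 0 := by simpa using ha0
      rw [Submodule.mem_comap, Algebra.linearMap_apply, algebraMap_dual_apply ha0' ψ b]
      exact FractionalIdeal.mul_mem_mul (dual_apply_div_mem_inv_coeIdeal ha0' ψ)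
        (FractionalIdeal.mem_coeIdeal_of_mem _ b.2)
    rintro _ ⟨r, hr, rfl⟩
    exact hle hr
  · rintro x hx _ ⟨b, hb, rfl⟩
    obtain ⟨ψ, hψ⟩ := exists_dual_of_mem_inv_coeIdeal hI hx
    exact ⟨ψ ⟨b, hb⟩, apply_mem_traceIdeal ψ _, hψ ⟨b, hb⟩⟩

end TraceIdeal

section Subtr

variable {R : Type u} {K : Type*} [CommRing R] [IsDomain R] [IsNoetherianRing R] [Field K]
  [Algebra R K] [IsFractionRing R K] {I T : Ideal R}

theorem isTraceIdeal_iff_inv_mul_le : T.IsTraceIdeal ↔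
    (T : FractionalIdeal R⁰ K)⁻¹ * T ≤ T := by
  rw [isTraceIdeal_iff_traceIdeal_eq, ← coeIdeal_traceIdeal, FractionalIdeal.coeIdeal_le_coeIdeal]
  exact ⟨le_of_eq, fun h => h.antisymm (le_traceIdeal_self T)⟩

theorem inv_pow_mul_le_of_isTraceIdeal (hT : T.IsTraceIdeal) (hTI : T ≤ I) (k : ℕ) :
    (I : FractionalIdeal R⁰ K)⁻¹ ^ k * T ≤ T := by
  obtain rfl | hT0 := eq_or_ne T ⊥
  · simp
  have hinv : (I : FractionalIdeal R⁰ K)⁻¹ ≤ (T : FractionalIdeal R⁰ K)⁻¹ :=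
    FractionalIdeal.inv_anti_mono (FractionalIdeal.coeIdeal_ne_zero.2 hT0)
      (FractionalIdeal.coeIdeal_ne_zero.2 (ne_bot_of_le_ne_bot hT0 hTI))
      ((FractionalIdeal.coeIdeal_le_coeIdeal K).2 hTI)
  induction k with
  | zero => simp
  | succ k ih =>
    calc (I : FractionalIdeal R⁰ K)⁻¹ ^ (k + 1) * T
        = (I : FractionalIdeal R⁰ K)⁻¹ ^ k * ((I : FractionalIdeal R⁰ K)⁻¹ * T) := by ring
      _ ≤ (I : FractionalIdeal R⁰ K)⁻¹ ^ k * ((T : FractionalIdeal R⁰ K)⁻¹ * T) := by gcongr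
      _ ≤ (I : FractionalIdeal R⁰ K)⁻¹ ^ k * T := by
        gcongr
        exact isTraceIdeal_iff_inv_mul_le.1 hT
      _ ≤ T := ih

theorem isTraceIdeal_of_coeIdeal_eq_inv {J : FractionalIdeal R⁰ K} (hJ : J * J ≤ J)
    (hT : (T : FractionalIdeal R⁰ K) = J⁻¹) : T.IsTraceIdeal :=
  isTraceIdeal_iff_inv_mul_le.2 (hT ▸ inv_inv_mul_inv_le hJ)

theorem isGreatest_subtr_of_pow_stable (hI0 : I ≠ ⊥)
    (hI : (I : FractionalIdeal R⁰ K)⁻¹⁻¹ ≤ I) {k₀ : ℕ}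
    (hk₀ : ∀ k ≥ k₀, (I : FractionalIdeal R⁰ K)⁻¹ ^ k₀ = (I : FractionalIdeal R⁰ K)⁻¹ ^ k) :
    IsGreatest {T : Ideal R | T.IsTraceIdeal ∧ T ≤ I} I.subtr ∧
      (I.subtr : FractionalIdeal R⁰ K) = ((I : FractionalIdeal R⁰ K)⁻¹ ^ k₀)⁻¹ := by
  set F := (I : FractionalIdeal R⁰ K)⁻¹
  have hF : 1 ≤ F := FractionalIdeal.one_le.2 (FractionalIdeal.one_mem_inv_coe_ideal hI0)
  have hJ0 : F ^ k₀ ≠ 0 := (zero_lt_one.trans_le (one_le_pow₀ hF)).ne'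
  have hJJ : F ^ k₀ * F ^ k₀ ≤ F ^ k₀ := by
    rw [← pow_add, ← hk₀ _ le_self_add]
  have hFJ : F ≤ F ^ k₀ := by
    rw [hk₀ (k₀ + 1) (Nat.le_succ _), pow_succ]
    exact le_mul_of_one_le_left' (one_le_pow₀ hF)
  have hinv : (F ^ k₀)⁻¹ ≤ I :=
    (FractionalIdeal.inv_anti_mono (zero_lt_one.trans_le hF).ne' hJ0 hFJ).trans hI
  obtain ⟨T, hT⟩ := FractionalIdeal.le_one_iff_exists_coeIdeal.1
    (hinv.trans FractionalIdeal.coeIdeal_le_one)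
  have hgreatest : IsGreatest {T : Ideal R | T.IsTraceIdeal ∧ T ≤ I} T := by
    refine ⟨⟨isTraceIdeal_of_coeIdeal_eq_inv hJJ hT,
      (FractionalIdeal.coeIdeal_le_coeIdeal K).1 (hT ▸ hinv)⟩, fun T' ⟨hT', hT'I⟩ => ?_⟩
    rw [← FractionalIdeal.coeIdeal_le_coeIdeal K, hT, le_inv_iff_mul_le_one hJ0, mul_comm]
    exact (inv_pow_mul_le_of_isTraceIdeal hT' hT'I k₀).trans FractionalIdeal.coeIdeal_le_one
  have hsubtr : I.subtr = T := hgreatest.isLUB.sSup_eq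
  rw [hsubtr]
  exact ⟨hgreatest, hT⟩

end Subtr

section Stabilization

variable {R K : Type*} [CommRing R] [IsDomain R] [IsNoetherianRing R] [Field K] [Algebra R K]
  [IsFractionRing R K] {J L : FractionalIdeal R⁰ K}

theorem isIntegral_of_mem_of_mul_le (hJ : J ≠ 0) (hLJ : L * J ≤ J) {x : K} (hx : x ∈ L) :
    IsIntegral R x := by
  have := FractionalIdeal.isNoetherian J
  exact isIntegral_of_smul_mem_submodule (J : Submodule R K)
    (FractionalIdeal.coeToSubmodule_ne_bot.2 hJ) (Module.Finite.iff_fg.1 inferInstance) x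
    fun y hy => hLJ (FractionalIdeal.mul_mem_mul hx hy)

theorem exists_forall_ge_eq_of_monotone_of_le {f : ℕ → FractionalIdeal R⁰ K} (hf : Monotone f)
    (hfJ : ∀ n, f n ≤ J) : ∃ k₀, ∀ k ≥ k₀, f k₀ = f k := by
  have := FractionalIdeal.isNoetherian J
  let e := (Submodule.mapIic (J : Submodule R K)).symm
  obtain ⟨k₀, hk₀⟩ := monotone_stabilizes_iff_noetherian.2 this
    ⟨fun n => e ⟨f n, hfJ n⟩, fun m n hmn => e.monotone (hf hmn)⟩
  have hcoe (k : ℕ) (hk : k ≥ k₀) : (f k₀ : Submodule R K) = f k :=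
    Subtype.mk.inj (e.injective (hk₀ k hk))
  exact ⟨k₀, fun k hk => FractionalIdeal.coeToSubmodule_injective (hcoe k hk)⟩

end Stabilization

section Conductor

variable (R K : Type*) [CommRing R] [Field K] [Algebra R K] [IsFractionRing R K]
  [Module.Finite R (integralClosure R K)]

/-- The integral closure of `R` in its fraction field `K`, as a fractional ideal of `R`; finiteness
over `R` provides the common denominator. -/
def integralClosureFractionalIdeal : FractionalIdeal R⁰ K :=
  ⟨Subalgebra.toSubmodule (integralClosure R K),
    FractionalIdeal.isFractional_of_fg (Module.Finite.iff_fg.1 ‹_›)⟩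

variable {R K}

theorem mem_integralClosureFractionalIdeal {x : K} :
    x ∈ integralClosureFractionalIdeal R K ↔ IsIntegral R x :=
  Iff.rfl

theorem one_le_integralClosureFractionalIdeal : 1 ≤ integralClosureFractionalIdeal R K :=
  FractionalIdeal.one_le.2 (mem_integralClosureFractionalIdeal.2 isIntegral_one)

theorem integralClosureFractionalIdeal_mul_self_le :
    integralClosureFractionalIdeal R K * integralClosureFractionalIdeal R K ≤
      integralClosureFractionalIdeal R K :=
  FractionalIdeal.mul_le.2 fun _ hx _ hy => mem_integralClosureFractionalIdeal.2
    ((mem_integralClosureFractionalIdeal.1 hx).mul (mem_integralClosureFractionalIdeal.1 hy))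

theorem integralClosureFractionalIdeal_ne_zero : integralClosureFractionalIdeal R K ≠ 0 :=
  (zero_lt_one.trans_le one_le_integralClosureFractionalIdeal).ne'

variable [IsDomain R]

theorem coeIdeal_integralClosureConductor :
    (integralClosureConductor R K : FractionalIdeal R⁰ K) =
      (integralClosureFractionalIdeal R K)⁻¹ := by
  ext x
  rw [FractionalIdeal.mem_inv_iff integralClosureFractionalIdeal_ne_zero,
    FractionalIdeal.mem_coeIdeal]
  refine ⟨?_, fun hx => ?_⟩
  · rintro ⟨r, hr, rfl⟩ y hy
    exact (FractionalIdeal.mem_one_iff _).2 (hr y hy)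
  · obtain ⟨r, rfl⟩ : ∃ r, algebraMap R K r = x := by
      simpa [FractionalIdeal.mem_one_iff] using
        hx 1 (mem_integralClosureFractionalIdeal.2 isIntegral_one)
    exact ⟨r, fun y hy => (FractionalIdeal.mem_one_iff _).1 (hx y hy), rfl⟩

theorem integralClosureConductor_ne_bot : integralClosureConductor R K ≠ ⊥ := by
  rw [← FractionalIdeal.coeIdeal_ne_zero (K := K), coeIdeal_integralClosureConductor]
  exact right_ne_zero_of_mul
    (FractionalIdeal.bot_lt_mul_inv integralClosureFractionalIdeal_ne_zero).ne'

variable [IsNoetherianRing R] {I : Ideal R}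

theorem inv_coeIdeal_le_integralClosureFractionalIdeal (hI : integralClosureConductor R K ≤ I) :
    (I : FractionalIdeal R⁰ K)⁻¹ ≤ integralClosureFractionalIdeal R K := by
  have hC : (integralClosureConductor R K : FractionalIdeal R⁰ K) ≠ 0 :=
    FractionalIdeal.coeIdeal_ne_zero.2 integralClosureConductor_ne_bot
  have hI0 : (I : FractionalIdeal R⁰ K) ≠ 0 :=
    FractionalIdeal.coeIdeal_ne_zero.2 (ne_bot_of_le_ne_bot integralClosureConductor_ne_bot hI)
  have hle : (I : FractionalIdeal R⁰ K)⁻¹ ≤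
      (integralClosureConductor R K : FractionalIdeal R⁰ K)⁻¹ :=
    FractionalIdeal.inv_anti_mono hC hI0 ((FractionalIdeal.coeIdeal_le_coeIdeal K).2 hI)
  rw [coeIdeal_integralClosureConductor] at hC hle
  exact fun x hx => mem_integralClosureFractionalIdeal.2 <| isIntegral_of_mem_of_mul_le hC
    (inv_inv_mul_inv_le integralClosureFractionalIdeal_mul_self_le) (hle hx)

theorem inv_coeIdeal_pow_le_integralClosureFractionalIdeal
    (hI : integralClosureConductor R K ≤ I) (k : ℕ) :
    (I : FractionalIdeal R⁰ K)⁻¹ ^ k ≤ integralClosureFractionalIdeal R K := by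
  induction k with
  | zero => exact (pow_zero _).trans_le one_le_integralClosureFractionalIdeal
  | succ k ih =>
    rw [pow_succ]
    exact (mul_le_mul' ih (inv_coeIdeal_le_integralClosureFractionalIdeal hI)).trans
      integralClosureFractionalIdeal_mul_self_le

end Conductor

theorem mainTheorem7_general {R : Type u} [CommRing R] [IsDomain R] [IsNoetherianRing R]
    [Ring.KrullDimLE 1 R] {K : Type*} [Field K] [Algebra R K] [IsFractionRing R K]
    [Module.Finite R (integralClosure R K)] {d : ℕ}
    (hR : CategoryTheory.HasInjectiveDimensionLE (ModuleCat.of R R) d)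
    (I : Ideal R) (hI : integralClosureConductor R K ≤ I) :
    (∃ k₀ : ℕ, ∀ k ≥ k₀, (I : FractionalIdeal R⁰ K)⁻¹ ^ k₀ = (I : FractionalIdeal R⁰ K)⁻¹ ^ k) ∧
    ∀ k₀ : ℕ,
      (∀ k ≥ k₀, (I : FractionalIdeal R⁰ K)⁻¹ ^ k₀ = (I : FractionalIdeal R⁰ K)⁻¹ ^ k) →
      IsGreatest {T : Ideal R | T.IsTraceIdeal ∧ T ≤ I} I.subtr ∧
      (I.subtr : FractionalIdeal R⁰ K) = ((I : FractionalIdeal R⁰ K)⁻¹ ^ k₀)⁻¹ := by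
  have hI0 : I ≠ ⊥ := ne_bot_of_le_ne_bot integralClosureConductor_ne_bot hI
  have hmono : Monotone fun k : ℕ => (I : FractionalIdeal R⁰ K)⁻¹ ^ k :=
    pow_right_mono₀ (FractionalIdeal.one_le.2 (FractionalIdeal.one_mem_inv_coe_ideal hI0))
  exact ⟨exists_forall_ge_eq_of_monotone_of_le hmono
      (inv_coeIdeal_pow_le_integralClosureFractionalIdeal hI),
    fun _ => isGreatest_subtr_of_pow_stable hI0
      (inv_inv_coeIdeal_le (surjective_dual_eval_of_hasInjectiveDimensionLE hR I))⟩

theorem mainTheorem7 {R : Type u} [CommRing R] [IsDomain R] [IsNoetherianRing R] [IsLocalRing R]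
    {K : Type*} [Field K] [Algebra R K] [IsFractionRing R K]
    (hdim : ringKrullDim R = 1)
    [IsDiscreteValuationRing (integralClosure R K)]
    [Module.Finite R (integralClosure R K)]
    (hres : Function.Bijective
      (IsLocalRing.ResidueField.map (algebraMap R (integralClosure R K))))
    (hR : IsGorensteinLocalRing R)
    (I : Ideal R) (hI : integralClosureConductor R K ≤ I) :
    (∃ k₀ : ℕ, ∀ k ≥ k₀, (I : FractionalIdeal R⁰ K)⁻¹ ^ k₀ = (I : FractionalIdeal R⁰ K)⁻¹ ^ k) ∧
    ∀ k₀ : ℕ,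
      (∀ k ≥ k₀, (I : FractionalIdeal R⁰ K)⁻¹ ^ k₀ = (I : FractionalIdeal R⁰ K)⁻¹ ^ k) →
      IsGreatest {T : Ideal R | T.IsTraceIdeal ∧ T ≤ I} I.subtr ∧
      (I.subtr : FractionalIdeal R⁰ K) = ((I : FractionalIdeal R⁰ K)⁻¹ ^ k₀)⁻¹ := by
  have : Ring.KrullDimLE 1 R := Ring.krullDimLE_iff.2 (by simp [hdim])
  obtain ⟨d, hd⟩ := hR.exists_injectiveDimensionLE
  exact mainTheorem7_general hd I hI
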